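/- Notation: for $n\ge 0$ and $z,w\in\mathbb C^n$ put $z\cdot w=\sum_j z_jw_j$, $z^2=z\cdot z$, $|z|^2=\sum_j|z_j|^2$. Let $d\gamma(\xi)=e^{-|\xi|^2}d\xi$ on $\mathbb R^n$ and $d\nu(z)=c_n e^{-|z|^2/2}dz$ on $\mathbb C^n$, where $c_n=(2\pi)^{-n}\pi^{-n/2}$. The Fock space $\mathcal F(\mathbb C^n)$ is the space of entire functions on $\mathbb C^n$ that are square integrable with respect to $\nu$, with the inner product of $L^2(\mathbb C^n,d\nu)$. For $a\in\mathbb R^n$ let $$\rho(a)F(z)=F(z+a)\,e^{-\frac12 a\cdot z}\,e^{-\frac14|a|^2},\qquad F\in\mathcal F(\mathbb C^n).$$ The Gauss–Bargmann transform $G:L^2(\mathbb R^n,d\gamma)\to\mathcal F(\mathbb C^n)$ is the isometry $$Gf(z)=e^{\frac14 z^2}\int_{\mathbb R^n} f(\xi)\,e^{iz\cdot\xi}\,d\gamma(\xi),$$ and $G^*:\mathcal F(\mathbb C^n)\to L^2(\mathbb R^n,d\gamma)$ is its adjoint. Theorem 1.2. A bounded linear operator $S$ on $\mathcal F(\mathbb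 C^n)$ satisfies $S\rho(a)=\rho(a)S$ for all $a\in\mathbb R^n$ if and only if there exists $m\in L^\infty(\mathbb R^n)$ such that, for all $F\in\mathcal F(\mathbb C^n)$ and $z\in\mathbb C^n$, $$SF(z)=e^{\frac14 z^2}\int_{\mathbb R^n} m(\xi)\,G^*F(\xi)\,e^{iz\cdot\xi}\,d\gamma(\xi).$$ Moreover, for every $m\in L^\infty(\mathbb R^n)$, this formula holds for all $F$ and $z$ if and only if $S=G\circ m\circ G^*$, where $m$ also denotes the operator of multiplication by $m$ on $L^2(\mathbb R^n,d\gamma)$. -/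

import Mathlib

open MeasureTheory Complex
open scoped ENNReal FourierTransform

noncomputable section
namespace FockSpace

/-- On `L¹ ∩ L²` the `L²` Fourier transform is the Fourier integral. -/
theorem fourier_L1_L2 {V : Type*} [NormedAddCommGroup V] [InnerProductSpace ℝ V]
    [FiniteDimensional ℝ V] [MeasurableSpace V] [BorelSpace V] (f : V → ℂ)
    (h1 : Integrable f) (h2 : MemLp f 2 volume) :
    (𝓕 (h2.toLp f) : Lp ℂ 2 (volume : Measure V)) =ᵐ[volume] (𝓕 f : V → ℂ) := by
  have hc : Continuous (𝓕 f : V → ℂ) :=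
    VectorFourier.fourierIntegral_continuous Real.continuous_fourierChar
      (L := innerₗ V) (by exact continuous_inner) h1
  refine ae_eq_of_integral_contDiff_smul_eq
    ((Lp.memLp (𝓕 (h2.toLp f))).locallyIntegrable (by norm_num)) hc.locallyIntegrable ?_
  intro g hg hgc
  have hg₁ : HasCompactSupport (Complex.ofRealCLM ∘ g) := hgc.comp_left rfl
  have hg₂ : ContDiff ℝ (⊤ : ℕ∞) (Complex.ofRealCLM ∘ g) := Complex.ofRealCLM.contDiff.comp hg
  set G := hg₁.toSchwartzMap hg₂ with hG
  have key := congrArg (fun T => T G) (Lp.fourier_toTemperedDistribution_eq (h2.toLp f))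
  simp only [TemperedDistribution.fourier_apply, Lp.toTemperedDistribution_apply] at key
  have e1 : ∫ x, g x • (𝓕 (h2.toLp f) : Lp ℂ 2 (volume : Measure V)) x
      = ∫ x, G x • (𝓕 (h2.toLp f) : Lp ℂ 2 (volume : Measure V)) x := by
    congr 1
  have e2 : ∫ x, g x • (𝓕 f : V → ℂ) x = ∫ x, G x • (𝓕 f : V → ℂ) x := by
    congr 1
  rw [e1, e2, ← key]
  have e3 : ∫ x, (𝓕 G) x • (h2.toLp f) x = ∫ x, (𝓕 G) x • f x := by
    refine integral_congr_ae ?_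
    filter_upwards [h2.coeFn_toLp] with x hx
    rw [hx]
  rw [e3]
  have := VectorFourier.integral_fourierIntegral_smul_eq_flip (L := innerₗ V) (μ := volume)
    (ν := volume) Real.continuous_fourierChar (by exact continuous_inner) (G.integrable) h1
  rw [flip_innerₗ] at this
  rw [SchwartzMap.fourier_coe]
  exact this

/-- Plancherel's theorem on `L¹ ∩ L²`. -/
theorem lintegral_fourier_sq {V : Type*} [NormedAddCommGroup V] [InnerProductSpace ℝ V]
    [FiniteDimensional ℝ V] [MeasurableSpace V] [BorelSpace V] (f : V → ℂ)
    (h1 : Integrable f) (h2 : MemLp f 2 volume) :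
    ∫⁻ x, ‖(𝓕 f : V → ℂ) x‖ₑ ^ 2 = ∫⁻ x, ‖f x‖ₑ ^ 2 := by
  have a1 : eLpNorm (𝓕 f : V → ℂ) 2 volume = eLpNorm f 2 volume := by
    rw [← eLpNorm_congr_ae (fourier_L1_L2 f h1 h2), ← eLpNorm_congr_ae h2.coeFn_toLp,
      ← Lp.enorm_def, ← Lp.enorm_def, ← ofReal_norm, ← ofReal_norm, Lp.norm_fourier_eq]
  have s := fun (u : V → ℂ) => eLpNorm_nnreal_pow_eq_lintegral (f := u) (p := 2) (μ := volume) (by norm_num)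
  have s1 := s f
  have s2 := s (𝓕 f : V → ℂ)
  simp only [NNReal.coe_ofNat, ENNReal.coe_ofNat, ENNReal.rpow_ofNat] at s1 s2
  rw [← s1, ← s2, a1]

/-- Real Euclidean space `ℝⁿ`. -/
abbrev Rn (n : ℕ) : Type := EuclideanSpace ℝ (Fin n)

/-- Complex space `ℂⁿ`, with Lebesgue measure `dz` as its volume. -/
abbrev Cn (n : ℕ) : Type := Fin n → ℂ

variable {n : ℕ}

/-- The inclusion `ℝⁿ ⊆ ℂⁿ`. -/
def toCn (x : Rn n) : Cn n := fun j => (x j : ℂ)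

/-- The measure `dγ(ξ) = exp (-|ξ|²) dξ` on `ℝⁿ`. -/
def gaussMeasure (n : ℕ) : Measure (Rn n) :=
  (volume : Measure (Rn n)).withDensity fun ξ => ENNReal.ofReal (Real.exp (-‖ξ‖ ^ 2))

/-- The normalizing constant `c_n = (2π)⁻ⁿ π^(-n/2)`, the one that makes `G` unitary. -/
def fockConst (n : ℕ) : ℝ := ((2 * Real.pi) ^ n * Real.pi ^ ((n : ℝ) / 2))⁻¹

/-- The measure `dν(z) = c_n exp (-|z|²/2) dz` on `ℂⁿ`. -/
def fockMeasure (n : ℕ) : Measure (Cn n) :=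
  (volume : Measure (Cn n)).withDensity fun z =>
    ENNReal.ofReal (fockConst n * Real.exp (-(∑ j, ‖z j‖ ^ 2) / 2))

/-- The entire functions on `ℂⁿ` that are square integrable for `ν`. -/
def fockSubmodule (n : ℕ) : Submodule ℂ (Cn n → ℂ) where
  carrier := {F | Differentiable ℂ F ∧ MemLp F 2 (fockMeasure n)}
  zero_mem' := ⟨differentiable_const _, MemLp.zero⟩
  add_mem' h h' := ⟨h.1.add h'.1, h.2.add h'.2⟩
  smul_mem' c _ h := ⟨h.1.const_smul c, h.2.const_smul c⟩

/-- The Fock space `𝓕(ℂⁿ)`: the entire functions in `L²(ℂⁿ, dν)`, with the norm of `L²(ℂⁿ, dν)`. -/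
def Fock (n : ℕ) : Type := fockSubmodule n

instance : AddCommGroup (Fock n) := inferInstanceAs (AddCommGroup (fockSubmodule n))
instance : Module ℂ (Fock n) := inferInstanceAs (Module ℂ (fockSubmodule n))
instance : CoeFun (Fock n) (fun _ => Cn n → ℂ) := ⟨fun F => F.1⟩

/-- The element of the Fock space given by a square integrable entire function. -/
def Fock.mk (F : Cn n → ℂ) (hF : F ∈ fockSubmodule n) : Fock n := ⟨F, hF⟩

theorem Fock.ext {F H : Fock n} (h : ∀ z, F z = H z) : F = H := Subtype.ext (funext h)
theorem Fock.differentiable (F : Fock n) : Differentiable ℂ (F : Cn n → ℂ) := F.2.1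
theorem Fock.memLp (F : Fock n) : MemLp (F : Cn n → ℂ) 2 (fockMeasure n) := F.2.2

theorem fockConst_pos (n : ℕ) : 0 < fockConst n := by unfold fockConst; positivity

theorem measurable_fockDensity : Measurable fun z : Cn n =>
    ENNReal.ofReal (fockConst n * Real.exp (-(∑ j, ‖z j‖ ^ 2) / 2)) := by
  generalize fockConst n = c
  fun_prop

/-- A set of `ν`-measure zero is Lebesgue null. -/
theorem volume_ac_fockMeasure : (volume : Measure (Cn n)) ≪ fockMeasure n := by
  refine withDensity_absolutelyContinuous' measurable_fockDensity.aemeasurable (.of_forall fun z => ?_)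
  simp only [ne_eq, ENNReal.ofReal_eq_zero, not_le]
  have := fockConst_pos n
  positivity

/-- The inclusion `𝓕(ℂⁿ) → L²(ℂⁿ, dν)`, as a linear map. -/
def Fock.toL2ₗ (n : ℕ) : Fock n →ₗ[ℂ] Lp ℂ 2 (fockMeasure n) where
  toFun F := F.memLp.toLp F
  map_add' F H := MemLp.toLp_add F.memLp H.memLp
  map_smul' c F := MemLp.toLp_const_smul c F.memLp

theorem Fock.toL2ₗ_injective : Function.Injective (Fock.toL2ₗ n) := by
  intro F H h
  have h1 : (F : Cn n → ℂ) =ᵐ[fockMeasure n] H := (MemLp.toLp_eq_toLp_iff F.memLp H.memLp).1 h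
  have h2 := Continuous.ae_eq_iff_eq volume F.differentiable.continuous
    H.differentiable.continuous |>.1 (volume_ac_fockMeasure.ae_eq h1)
  exact Fock.ext (congrFun h2)

/-- The norm `‖F‖² = ∫ |F(z)|² dν(z)`. -/
instance : NormedAddCommGroup (Fock n) :=
  NormedAddCommGroup.induced _ _ (Fock.toL2ₗ n) Fock.toL2ₗ_injective

/-- The inner product of `L²(ℂⁿ, dν)`. -/
instance : InnerProductSpace ℂ (Fock n) where
  norm_smul_le c F := by
    show ‖Fock.toL2ₗ n (c • F)‖ ≤ ‖c‖ * ‖Fock.toL2ₗ n F‖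
    rw [map_smul, norm_smul]
  inner F H := inner ℂ (Fock.toL2ₗ n F) (Fock.toL2ₗ n H)
  norm_sq_eq_re_inner F := norm_sq_eq_re_inner (𝕜 := ℂ) (Fock.toL2ₗ n F)
  conj_inner_symm _ _ := inner_conj_symm _ _
  add_left _ _ _ := by rw [map_add, inner_add_left]
  smul_left _ _ _ := by rw [map_smul, inner_smul_left]

/-- The inclusion `𝓕(ℂⁿ) → L²(ℂⁿ, dν)`. -/
def Fock.toL2 (n : ℕ) : Fock n →ₗᵢ[ℂ] Lp ℂ 2 (fockMeasure n) where
  toLinearMap := Fock.toL2ₗ n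
  norm_map' _ := rfl

theorem Fock.enorm_sq (F : Fock n) :
    ‖F‖ₑ ^ 2 = ∫⁻ z, ‖F z‖ₑ ^ 2 ∂(fockMeasure n) := by
  have h : ‖F‖ₑ = eLpNorm (F : Cn n → ℂ) 2 (fockMeasure n) := by
    rw [← ofReal_norm, ← (Fock.toL2 n).norm_map, ofReal_norm, Lp.enorm_def]
    exact eLpNorm_congr_ae F.memLp.coeFn_toLp
  have s := eLpNorm_nnreal_pow_eq_lintegral (f := (F : Cn n → ℂ)) (p := 2)
    (μ := fockMeasure n) (by norm_num)
  simp only [NNReal.coe_ofNat, ENNReal.coe_ofNat, ENNReal.rpow_ofNat] at s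
  rw [h, s]

theorem lintegral_fock (u : Cn n → ℝ≥0∞) :
    ∫⁻ z, u z ∂(fockMeasure n) =
      ∫⁻ z, ENNReal.ofReal (fockConst n * Real.exp (-(∑ j, ‖z j‖ ^ 2) / 2)) * u z := by
  rw [fockMeasure, lintegral_withDensity_eq_lintegral_mul_non_measurable _ measurable_fockDensity
    (.of_forall fun _ => ENNReal.ofReal_lt_top)]
  rfl

theorem lintegral_gauss (u : Rn n → ℝ≥0∞) :
    ∫⁻ z, u z ∂(gaussMeasure n) = ∫⁻ ξ, ENNReal.ofReal (Real.exp (-‖ξ‖ ^ 2)) * u ξ := by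
  rw [gaussMeasure, lintegral_withDensity_eq_lintegral_mul_non_measurable _ (by fun_prop)
    (.of_forall fun _ => ENNReal.ofReal_lt_top)]
  rfl

theorem memLp_two_of_lintegral {α : Type*} [MeasurableSpace α] {μ : Measure α} {u : α → ℂ}
    (hu : AEStronglyMeasurable u μ) (h : ∫⁻ z, ‖u z‖ₑ ^ 2 ∂μ < ∞) : MemLp u 2 μ := by
  refine ⟨hu, ?_⟩
  have s := eLpNorm_nnreal_pow_eq_lintegral (f := u) (p := 2) (μ := μ) (by norm_num)
  simp only [NNReal.coe_ofNat, ENNReal.coe_ofNat, ENNReal.rpow_ofNat] at s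
  rw [← s] at h
  by_contra h'
  rw [not_lt, top_le_iff] at h'
  simp [h'] at h

theorem enorm_cexp_sq (a : ℂ) : ‖cexp a‖ₑ ^ 2 = ENNReal.ofReal (Real.exp (2 * a.re)) := by
  rw [← ofReal_norm, ← ENNReal.ofReal_pow (norm_nonneg _), Complex.norm_exp, ← Real.exp_nat_mul]
  norm_num

theorem lintegral_gaussian {b : ℝ} (hb : 0 < b) :
    ∫⁻ ξ : Rn n, ENNReal.ofReal (Real.exp (-b * ‖ξ‖ ^ 2)) =
      ENNReal.ofReal ((Real.pi / b) ^ ((n : ℝ) / 2)) := by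
  have h := GaussianFourier.integral_rexp_neg_mul_sq_norm (V := Rn n) hb
  rw [finrank_euclideanSpace_fin] at h
  have hi : Integrable fun ξ : Rn n => Real.exp (-b * ‖ξ‖ ^ 2) := by
    refine Integrable.of_integral_ne_zero ?_
    rw [h]
    positivity
  rw [← ofReal_integral_eq_lintegral_ofReal hi (.of_forall fun _ => (Real.exp_pos _).le), h]

/-! ### The operators `ρ(w)` -/

/-- `ρ(w)F(z) = F(z + w) exp (-(z · w̄)/2) exp (-|w|²/4)` for functions on `ℂⁿ`. -/
def rhoFun (w : Cn n) (F : Cn n → ℂ) (z : Cn n) : ℂ :=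
  F (z + w) * cexp (-(z ⬝ᵥ star w) / 2) * cexp (-(∑ j, ‖w j‖ ^ 2 : ℝ) / 4)

theorem lintegral_rhoFun (w : Cn n) (F : Cn n → ℂ) :
    ∫⁻ z, ‖rhoFun w F z‖ₑ ^ 2 ∂(fockMeasure n) = ∫⁻ z, ‖F z‖ₑ ^ 2 ∂(fockMeasure n) := by
  rw [lintegral_fock, lintegral_fock]
  conv_rhs => rw [← lintegral_add_right_eq_self (μ := (volume : Measure (Cn n))) _ w]
  refine lintegral_congr fun z => ?_
  simp only [rhoFun, enorm_mul, mul_pow, enorm_cexp_sq]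
  have h0 : 0 ≤ fockConst n := (fockConst_pos n).le
  have hr : ∀ p q r s : ℝ≥0∞, p * (q * r * s) = p * r * s * q := fun p q r s => by ring
  rw [hr, ← ENNReal.ofReal_mul (by positivity), ← ENNReal.ofReal_mul (by positivity), mul_assoc,
    mul_assoc, ← Real.exp_add, ← Real.exp_add]
  congr 4
  have e : ∑ j, ‖(z + w) j‖ ^ 2
      = ∑ j, ‖z j‖ ^ 2 + ∑ j, ‖w j‖ ^ 2 + 2 * (z ⬝ᵥ star w).re := by
    simp only [dotProduct, Complex.re_sum, Finset.mul_sum, ← Finset.sum_add_distrib]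
    refine Finset.sum_congr rfl fun j _ => ?_
    simp only [Complex.sq_norm, Complex.normSq_apply, Pi.add_apply, Complex.add_re, Complex.add_im,
      Complex.mul_re, Pi.star_apply, Complex.star_def, Complex.conj_re, Complex.conj_im]
    ring
  rw [e]
  have e1 : (-(z ⬝ᵥ star w) / 2).re = -(z ⬝ᵥ star w).re / 2 := by simp
  have e2 : (-((∑ j, ‖w j‖ ^ 2 : ℝ) : ℂ) / 4).re = -(∑ j, ‖w j‖ ^ 2) / 4 := by
    rw [← Complex.ofReal_neg]
    norm_cast
  rw [e1, e2]
  ring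

theorem rhoFun_mem (w : Cn n) (F : Fock n) : rhoFun w F ∈ fockSubmodule n := by
  have hd : Differentiable ℂ (rhoFun w F) := by
    have := F.differentiable
    unfold rhoFun dotProduct
    fun_prop
  refine ⟨hd, memLp_two_of_lintegral hd.continuous.aestronglyMeasurable ?_⟩
  rw [lintegral_rhoFun, ← Fock.enorm_sq]
  exact ENNReal.pow_lt_top enorm_lt_top

/-- The operator `ρ(w)` on the Fock space, `ρ(w)F(z) = F(z + w) exp (-(z · w̄)/2 - |w|²/4)`. -/
def rho (w : Cn n) : Fock n →ₗᵢ[ℂ] Fock n where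
  toFun F := Fock.mk (rhoFun w F) (rhoFun_mem w F)
  map_add' F H := Fock.ext fun z => by
    show (F (z + w) + H (z + w)) * _ * _ = F (z + w) * _ * _ + H (z + w) * _ * _
    ring
  map_smul' c F := Fock.ext fun z => by
    show (c * F (z + w)) * _ * _ = c * (F (z + w) * _ * _)
    ring
  norm_map' F := by
    have h : ‖Fock.mk (rhoFun w F) (rhoFun_mem w F)‖ₑ ^ 2 = ‖F‖ₑ ^ 2 := by
      rw [Fock.enorm_sq, Fock.enorm_sq]
      exact lintegral_rhoFun w F
    have h' := (ENNReal.pow_right_strictMono two_ne_zero).injective h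
    simpa [← ofReal_norm, ENNReal.ofReal_eq_ofReal_iff] using h'

/-- For real `a`, `ρ(a)F(z) = F(z + a) exp (-(a · z)/2) exp (-|a|²/4)`. -/
theorem rho_toCn_apply (a : Rn n) (F : Fock n) (z : Cn n) :
    rho (toCn a) F z = F (z + toCn a) * cexp (-(z ⬝ᵥ toCn a) / 2) * cexp (-(‖a‖ ^ 2 : ℝ) / 4) := by
  have h1 : star (toCn a) = toCn a := by
    funext j
    simp [toCn]
  have h2 : ∑ j, ‖toCn a j‖ ^ 2 = ‖a‖ ^ 2 := by
    simp [toCn, EuclideanSpace.real_norm_sq_eq]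
  rw [← h2]
  show F (z + toCn a) * cexp (-(z ⬝ᵥ star (toCn a)) / 2) * _ = _
  rw [h1]

/-! ### The Gauss–Bargmann transform -/

/-- `L²(ℝⁿ, dγ)`. -/
abbrev GaussL2 (n : ℕ) : Type := Lp ℂ 2 (gaussMeasure n)

/-- `Gf(z) = exp (z²/4) ∫ f(ξ) exp (i z·ξ) dγ(ξ)`, with the bilinear `z² = z·z` and `z·ξ`. -/
def gaussBargmannFun (f : Rn n → ℂ) (z : Cn n) : ℂ :=
  cexp ((z ⬝ᵥ z) / 4) * ∫ ξ, f ξ * cexp (I * (z ⬝ᵥ toCn ξ)) ∂(gaussMeasure n)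

theorem memLp_exp (C : ℝ) : MemLp (fun ξ : Rn n => cexp (C * ‖ξ‖ : ℝ)) 2 (gaussMeasure n) := by
  refine memLp_two_of_lintegral (Continuous.aestronglyMeasurable (by fun_prop)) ?_
  rw [lintegral_gauss]
  have hb : ∀ ξ : Rn n, ENNReal.ofReal (Real.exp (-‖ξ‖ ^ 2)) * ‖cexp (C * ‖ξ‖ : ℝ)‖ₑ ^ 2 ≤
      ENNReal.ofReal (Real.exp (2 * C ^ 2)) *
        ENNReal.ofReal (Real.exp (-(1 / 2 : ℝ) * ‖ξ‖ ^ 2)) := fun ξ => by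
    rw [enorm_cexp_sq, ← ENNReal.ofReal_mul (Real.exp_pos _).le,
      ← ENNReal.ofReal_mul (Real.exp_pos _).le, ← Real.exp_add, ← Real.exp_add, Complex.ofReal_re]
    refine ENNReal.ofReal_le_ofReal (Real.exp_le_exp.2 ?_)
    nlinarith [sq_nonneg (‖ξ‖ - 2 * C)]
  refine (lintegral_mono hb).trans_lt ?_
  rw [lintegral_const_mul' _ _ ENNReal.ofReal_ne_top, lintegral_gaussian (by norm_num)]
  exact ENNReal.mul_lt_top ENNReal.ofReal_lt_top ENNReal.ofReal_lt_top

theorem norm_dot_toCn_le (z : Cn n) (ξ : Rn n) : ‖z ⬝ᵥ toCn ξ‖ ≤ n * ‖z‖ * ‖ξ‖ := by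
  unfold dotProduct toCn
  refine (norm_sum_le _ _).trans ?_
  have : ∀ j ∈ Finset.univ, ‖z j * (ξ j : ℂ)‖ ≤ ‖z‖ * ‖ξ‖ := fun j _ => by
    rw [norm_mul, Complex.norm_real]
    exact mul_le_mul (norm_le_pi_norm z j) (PiLp.norm_apply_le ξ j) (norm_nonneg _) (norm_nonneg _)
  refine (Finset.sum_le_sum this).trans (le_of_eq ?_)
  simp [mul_assoc]

theorem continuous_toCn : Continuous (toCn : Rn n → Cn n) := by
  unfold toCn
  fun_prop

theorem continuous_kernel (z : Cn n) : Continuous fun ξ : Rn n => cexp (I * (z ⬝ᵥ toCn ξ)) := by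
  have := continuous_toCn (n := n)
  unfold dotProduct
  fun_prop

theorem norm_kernel_le (z : Cn n) (ξ : Rn n) :
    ‖cexp (I * (z ⬝ᵥ toCn ξ))‖ ≤ Real.exp (n * ‖z‖ * ‖ξ‖) := by
  rw [Complex.norm_exp]
  refine Real.exp_le_exp.2 ((Complex.re_le_norm _).trans ?_)
  rw [norm_mul, Complex.norm_I, one_mul]
  exact norm_dot_toCn_le z ξ

theorem integrable_norm_mul_exp (f : GaussL2 n) (C : ℝ) :
    Integrable (fun ξ => ‖f ξ‖ * Real.exp (C * ‖ξ‖)) (gaussMeasure n) := by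
  have h := ((Lp.memLp f).integrable_mul (memLp_exp C)).norm
  refine h.congr (.of_forall fun ξ => ?_)
  simp [Complex.norm_exp]

theorem integrable_kernel (f : GaussL2 n) (z : Cn n) :
    Integrable (fun ξ => f ξ * cexp (I * (z ⬝ᵥ toCn ξ))) (gaussMeasure n) := by
  refine (integrable_norm_mul_exp f (n * ‖z‖)).mono'
    ((Lp.aestronglyMeasurable f).mul (continuous_kernel z).aestronglyMeasurable)
    (.of_forall fun ξ => ?_)
  rw [norm_mul]
  exact mul_le_mul_of_nonneg_left (norm_kernel_le z ξ) (norm_nonneg _)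

/-- The linear form `z ↦ z · ξ`. -/
def dotForm (ξ : Rn n) : Cn n →L[ℂ] ℂ :=
  ∑ j, (ξ j : ℂ) • ContinuousLinearMap.proj (R := ℂ) (φ := fun _ : Fin n => ℂ) j

theorem dotForm_apply (ξ : Rn n) (z : Cn n) : dotForm ξ z = z ⬝ᵥ toCn ξ := by
  simp [dotForm, dotProduct, toCn, mul_comm]

theorem norm_dotForm_le (ξ : Rn n) : ‖dotForm ξ‖ ≤ n * ‖ξ‖ := by
  refine ContinuousLinearMap.opNorm_le_bound _ (by positivity) fun z => ?_
  rw [dotForm_apply]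
  exact (norm_dot_toCn_le z ξ).trans (le_of_eq (by ring))

theorem gaussBargmannFun_differentiable (f : GaussL2 n) :
    Differentiable ℂ (gaussBargmannFun f) := by
  have h1 : Differentiable ℂ fun z : Cn n => cexp ((z ⬝ᵥ z) / 4) := by
    unfold dotProduct
    fun_prop
  refine h1.mul fun z₀ => ?_
  have hcd : Continuous (dotForm (n := n)) := by
    unfold dotForm
    fun_prop
  refine (hasFDerivAt_integral_of_dominated_of_fderiv_le (𝕜 := ℂ) (s := Metric.ball z₀ 1)
    (F' := fun z ξ => (f ξ * (cexp (I * (z ⬝ᵥ toCn ξ)) * I)) • dotForm ξ)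
    (bound := fun ξ => ‖f ξ‖ * Real.exp ((n * (‖z₀‖ + 1) + n) * ‖ξ‖))
    (Metric.ball_mem_nhds z₀ one_pos)
    (.of_forall fun z => (integrable_kernel f z).aestronglyMeasurable) (integrable_kernel f z₀)
    ?_ (.of_forall fun ξ z hz => ?_) (integrable_norm_mul_exp f _)
    (.of_forall fun ξ z _ => ?_)).differentiableAt
  · exact ((Lp.aestronglyMeasurable f).mul
      ((continuous_kernel z₀).mul continuous_const).aestronglyMeasurable).smul
      hcd.aestronglyMeasurable
  · rw [norm_smul, norm_mul, norm_mul, Complex.norm_I, mul_one, mul_assoc, add_mul, Real.exp_add]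
    refine mul_le_mul_of_nonneg_left (mul_le_mul ?_ ?_ (norm_nonneg _) (Real.exp_pos _).le)
      (norm_nonneg _)
    · refine (norm_kernel_le z ξ).trans (Real.exp_le_exp.2 ?_)
      have hz' : ‖z‖ ≤ ‖z₀‖ + 1 := by
        have := norm_lt_of_mem_ball hz
        linarith
      gcongr
    · refine (norm_dotForm_le ξ).trans ?_
      linarith [Real.add_one_le_exp ((n : ℝ) * ‖ξ‖)]
  · have h2 : HasFDerivAt (fun z : Cn n => I * (z ⬝ᵥ toCn ξ)) (I • dotForm ξ) z := by
      have := ((dotForm ξ).hasFDerivAt (x := z)).const_mul I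
      simpa [dotForm_apply] using this
    have h3 := (h2.cexp).const_mul (f ξ)
    simpa [smul_smul, mul_assoc] using h3

/-- The point `x + iy` of `ℂⁿ`. -/
def toComplex (p : Rn n × Rn n) : Cn n := fun j => ⟨p.1 j, p.2 j⟩

theorem measurePreserving_toComplex : MeasurePreserving (toComplex (n := n)) := by
  have h1 := (PiLp.volume_preserving_ofLp (Fin n)).prod (PiLp.volume_preserving_ofLp (Fin n))
  have h2 := (volume_measurePreserving_arrowProdEquivProdArrow ℝ ℝ (Fin n)).symm
  have h3 := volume_preserving_pi fun _ : Fin n => Complex.volume_preserving_equiv_real_prod.symm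
  exact (h3.comp h2).comp h1

theorem sum_toComplex (p : Rn n × Rn n) :
    ∑ j, ‖toComplex p j‖ ^ 2 = ‖p.1‖ ^ 2 + ‖p.2‖ ^ 2 := by
  simp only [EuclideanSpace.real_norm_sq_eq, ← Finset.sum_add_distrib]
  refine Finset.sum_congr rfl fun j _ => ?_
  simp only [toComplex, Complex.sq_norm, Complex.normSq_apply]
  ring

theorem dot_toComplex_re (p : Rn n × Rn n) :
    (toComplex p ⬝ᵥ toComplex p).re = ‖p.1‖ ^ 2 - ‖p.2‖ ^ 2 := by
  simp only [EuclideanSpace.real_norm_sq_eq, ← Finset.sum_sub_distrib, dotProduct, Complex.re_sum]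
  refine Finset.sum_congr rfl fun j _ => ?_
  simp only [toComplex, Complex.mul_re]
  ring

theorem I_dot_toComplex (x y ξ : Rn n) :
    I * (toComplex (x, y) ⬝ᵥ toCn ξ) = (inner ℝ ξ x : ℝ) * I - (inner ℝ y ξ : ℝ) := by
  simp only [dotProduct, toComplex, toCn, PiLp.inner_apply, Complex.ofReal_sum, Finset.mul_sum,
    Finset.sum_mul, ← Finset.sum_sub_distrib]
  refine Finset.sum_congr rfl fun j _ => ?_
  apply Complex.ext <;> simp [mul_comm]

/-- `f(ξ) exp (-|ξ|² - y·ξ)`. -/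
def auxFun (f : GaussL2 n) (y ξ : Rn n) : ℂ := f ξ * cexp (-‖ξ‖ ^ 2 - inner ℝ y ξ : ℝ)

theorem integral_gauss (u : Rn n → ℂ) :
    ∫ ξ, u ξ ∂(gaussMeasure n) = ∫ ξ, u ξ * cexp (-‖ξ‖ ^ 2 : ℝ) := by
  rw [gaussMeasure, integral_withDensity_eq_integral_toReal_smul (by fun_prop)
    (.of_forall fun _ => ENNReal.ofReal_lt_top)]
  refine integral_congr_ae (.of_forall fun ξ => ?_)
  simp only [ENNReal.toReal_ofReal (Real.exp_pos _).le, Complex.real_smul, Complex.ofReal_exp]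
  ring

theorem integrable_auxFun (f : GaussL2 n) (y : Rn n) : Integrable (auxFun f y) := by
  have h := (integrable_withDensity_iff_integrable_smul' (by fun_prop)
    (.of_forall fun _ => ENNReal.ofReal_lt_top)).1 (integrable_kernel f (toComplex (0, y)))
  refine h.congr (.of_forall fun ξ => ?_)
  simp only [ENNReal.toReal_ofReal (Real.exp_pos _).le, Complex.real_smul, Complex.ofReal_exp,
    I_dot_toComplex, auxFun]
  rw [mul_left_comm, ← Complex.exp_add]
  congr 2
  simp
  ring

theorem auxFun_enorm_sq (f : GaussL2 n) (y ξ : Rn n) : ‖auxFun f y ξ‖ₑ ^ 2 =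
    ‖f ξ‖ₑ ^ 2 * ENNReal.ofReal (Real.exp (2 * (-‖ξ‖ ^ 2 - inner ℝ y ξ))) := by
  rw [auxFun, enorm_mul, mul_pow, enorm_cexp_sq, Complex.ofReal_re]

theorem lintegral_gaussL2 (f : GaussL2 n) :
    ∫⁻ ξ, ‖f ξ‖ₑ ^ 2 * ENNReal.ofReal (Real.exp (-‖ξ‖ ^ 2)) = ‖f‖ₑ ^ 2 := by
  have s := eLpNorm_nnreal_pow_eq_lintegral (f := f) (p := 2)
    (μ := gaussMeasure n) (by norm_num)
  simp only [NNReal.coe_ofNat, ENNReal.coe_ofNat, ENNReal.rpow_ofNat] at s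
  rw [Lp.enorm_def, s, lintegral_gauss]
  exact lintegral_congr fun ξ => mul_comm _ _

theorem memLp_auxFun (f : GaussL2 n) (y : Rn n) : MemLp (auxFun f y) 2 volume := by
  refine memLp_two_of_lintegral (integrable_auxFun f y).aestronglyMeasurable ?_
  have hb : ∀ ξ, ‖auxFun f y ξ‖ₑ ^ 2 ≤ ENNReal.ofReal (Real.exp (‖y‖ ^ 2)) *
      (‖f ξ‖ₑ ^ 2 * ENNReal.ofReal (Real.exp (-‖ξ‖ ^ 2))) := fun ξ => by
    rw [auxFun_enorm_sq, mul_left_comm, ← ENNReal.ofReal_mul (Real.exp_pos _).le, ← Real.exp_add]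
    gcongr
    have h := norm_add_sq_real y ξ
    have h0 := sq_nonneg ‖y + ξ‖
    linarith
  refine (lintegral_mono hb).trans_lt ?_
  rw [lintegral_const_mul' _ _ ENNReal.ofReal_ne_top, lintegral_gaussL2]
  exact ENNReal.mul_lt_top ENNReal.ofReal_lt_top (ENNReal.pow_lt_top enorm_lt_top)

theorem integral_kernel_eq (f : GaussL2 n) (x y : Rn n) :
    ∫ ξ, f ξ * cexp (I * (toComplex (x, y) ⬝ᵥ toCn ξ)) ∂(gaussMeasure n) =
      (𝓕 (auxFun f y) : Rn n → ℂ) ((-(2 * Real.pi)⁻¹ : ℝ) • x) := by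
  rw [integral_gauss, Real.fourier_eq']
  refine integral_congr_ae (.of_forall fun ξ => ?_)
  simp only [auxFun, I_dot_toComplex, smul_eq_mul, inner_smul_right]
  rw [mul_assoc, ← Complex.exp_add, mul_left_comm, ← Complex.exp_add]
  congr 2
  have hp : (Real.pi : ℂ) ≠ 0 := Complex.ofReal_ne_zero.2 Real.pi_ne_zero
  push_cast
  field_simp
  ring

theorem weight_eq (f : GaussL2 n) (x y : Rn n) :
    ENNReal.ofReal (fockConst n * Real.exp (-(∑ j, ‖toComplex (x, y) j‖ ^ 2) / 2)) *
      ‖gaussBargmannFun f (toComplex (x, y))‖ₑ ^ 2 =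
    ENNReal.ofReal (fockConst n * Real.exp (-‖y‖ ^ 2)) *
      ‖(𝓕 (auxFun f y) : Rn n → ℂ) ((-(2 * Real.pi)⁻¹ : ℝ) • x)‖ₑ ^ 2 := by
  have hc := fockConst_pos n
  rw [gaussBargmannFun, enorm_mul, mul_pow, enorm_cexp_sq, integral_kernel_eq, ← mul_assoc,
    ← ENNReal.ofReal_mul (by positivity), mul_assoc, ← Real.exp_add, sum_toComplex]
  have e : (toComplex (x, y) ⬝ᵥ toComplex (x, y) / 4).re = (‖x‖ ^ 2 - ‖y‖ ^ 2) / 4 := by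
    have := dot_toComplex_re (x, y)
    simp only at this
    rw [← this]
    simp
  rw [e]
  congr 5
  ring

theorem lintegral_comp_smul' (u : Rn n → ℝ≥0∞) (hu : Measurable u) :
    ∫⁻ x : Rn n, u ((-(2 * Real.pi)⁻¹ : ℝ) • x) =
      ENNReal.ofReal ((2 * Real.pi) ^ n) * ∫⁻ x, u x := by
  have hr : (-(2 * Real.pi)⁻¹ : ℝ) ≠ 0 := by
    have := Real.pi_pos
    exact neg_ne_zero.2 (by positivity)
  have h := lintegral_map (μ := (volume : Measure (Rn n))) hu
    (measurable_const_smul (-(2 * Real.pi)⁻¹ : ℝ))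
  rw [← h, Measure.map_addHaar_smul _ hr, lintegral_smul_measure, finrank_euclideanSpace_fin,
    smul_eq_mul]
  congr 2
  rw [abs_inv, abs_pow, abs_neg, abs_of_pos (by have := Real.pi_pos; positivity), inv_pow, inv_inv]

/-- `G` is isometric. -/
theorem lintegral_gaussBargmannFun (f : GaussL2 n) :
    ∫⁻ z, ‖gaussBargmannFun f z‖ₑ ^ 2 ∂(fockMeasure n) = ‖f‖ₑ ^ 2 := by
  have hc := fockConst_pos n
  have hpi := Real.pi_pos
  have hmf : Measurable fun ξ => ‖f ξ‖ₑ ^ 2 := (Lp.stronglyMeasurable f).measurable.enorm.pow_const 2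
  have hm : Measurable fun z => ENNReal.ofReal (fockConst n * Real.exp (-(∑ j, ‖z j‖ ^ 2) / 2)) *
      ‖gaussBargmannFun f z‖ₑ ^ 2 :=
    measurable_fockDensity.mul
      ((gaussBargmannFun_differentiable f).continuous.measurable.enorm.pow_const 2)
  rw [lintegral_fock, ← measurePreserving_toComplex.lintegral_comp hm, Measure.volume_eq_prod,
    lintegral_prod_symm (fun p => ENNReal.ofReal (fockConst n *
      Real.exp (-(∑ j, ‖toComplex p j‖ ^ 2) / 2)) * ‖gaussBargmannFun f (toComplex p)‖ₑ ^ 2)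
      (hm.comp measurePreserving_toComplex.measurable).aemeasurable]
  simp only [weight_eq]
  have step : ∀ y : Rn n, ∫⁻ x : Rn n, ENNReal.ofReal (fockConst n * Real.exp (-‖y‖ ^ 2)) *
      ‖(𝓕 (auxFun f y) : Rn n → ℂ) ((-(2 * Real.pi)⁻¹ : ℝ) • x)‖ₑ ^ 2 =
      ∫⁻ ξ, (‖f ξ‖ₑ ^ 2 * ENNReal.ofReal (Real.exp (-‖ξ‖ ^ 2))) *
        ENNReal.ofReal (fockConst n * (2 * Real.pi) ^ n * Real.exp (-1 * ‖y + ξ‖ ^ 2)) := by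
    intro y
    have hcF : Continuous (𝓕 (auxFun f y) : Rn n → ℂ) :=
      VectorFourier.fourierIntegral_continuous Real.continuous_fourierChar
        (L := innerₗ (Rn n)) (by exact continuous_inner) (integrable_auxFun f y)
    rw [lintegral_const_mul' _ _ ENNReal.ofReal_ne_top,
      lintegral_comp_smul' (fun x => ‖(𝓕 (auxFun f y) : Rn n → ℂ) x‖ₑ ^ 2)
        (hcF.measurable.enorm.pow_const 2),
      lintegral_fourier_sq _ (integrable_auxFun f y) (memLp_auxFun f y), ← mul_assoc,
      ← ENNReal.ofReal_mul (by positivity), ← lintegral_const_mul' _ _ ENNReal.ofReal_ne_top]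
    refine lintegral_congr fun ξ => ?_
    rw [auxFun_enorm_sq, mul_left_comm, mul_assoc (‖f ξ‖ₑ ^ 2), ← ENNReal.ofReal_mul (by positivity),
      ← ENNReal.ofReal_mul (by positivity)]
    congr 2
    have e1 : ∀ a b p : ℝ, fockConst n * Real.exp a * p * Real.exp b =
        fockConst n * p * Real.exp (a + b) := fun a b p => by rw [Real.exp_add]; ring
    have e2 : ∀ a b p : ℝ, Real.exp a * (fockConst n * p * Real.exp b) =
        fockConst n * p * Real.exp (a + b) := fun a b p => by rw [Real.exp_add]; ring
    rw [e1, e2, norm_add_sq_real]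
    congr 2
    ring
  simp only [step]
  rw [lintegral_lintegral_swap]
  · have inner_int : ∀ ξ : Rn n, ∫⁻ y : Rn n,
        (‖f ξ‖ₑ ^ 2 * ENNReal.ofReal (Real.exp (-‖ξ‖ ^ 2))) *
        ENNReal.ofReal (fockConst n * (2 * Real.pi) ^ n * Real.exp (-1 * ‖y + ξ‖ ^ 2)) =
        ‖f ξ‖ₑ ^ 2 * ENNReal.ofReal (Real.exp (-‖ξ‖ ^ 2)) := by
      intro ξ
      rw [lintegral_const_mul' _ _ (by finiteness),
        lintegral_add_right_eq_self (μ := (volume : Measure (Rn n)))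
          (fun y => ENNReal.ofReal (fockConst n * (2 * Real.pi) ^ n * Real.exp (-1 * ‖y‖ ^ 2))) ξ]
      simp only [ENNReal.ofReal_mul (p := fockConst n * (2 * Real.pi) ^ n) (by positivity)]
      rw [lintegral_const_mul' _ _ ENNReal.ofReal_ne_top, lintegral_gaussian one_pos,
        ← ENNReal.ofReal_mul (by positivity), div_one, mul_assoc (fockConst n), fockConst,
        inv_mul_cancel₀ (by positivity), ENNReal.ofReal_one, mul_one]
    simp only [inner_int]
    exact lintegral_gaussL2 f
  · refine Measurable.aemeasurable ?_
    generalize fockConst n * (2 * Real.pi) ^ n = c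
    have h1 : Measurable fun p : Rn n × Rn n => ‖f p.2‖ₑ ^ 2 := hmf.comp measurable_snd
    unfold Function.uncurry
    fun_prop

theorem gaussBargmannFun_mem (f : GaussL2 n) : gaussBargmannFun f ∈ fockSubmodule n := by
  have hd := gaussBargmannFun_differentiable f
  refine ⟨hd, memLp_two_of_lintegral hd.continuous.aestronglyMeasurable ?_⟩
  rw [lintegral_gaussBargmannFun]
  exact ENNReal.pow_lt_top enorm_lt_top

/-- The Gauss–Bargmann transform `G : L²(ℝⁿ, dγ) → 𝓕(ℂⁿ)`. -/
def gaussBargmann (n : ℕ) : GaussL2 n →ₗᵢ[ℂ] Fock n where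
  toFun f := Fock.mk (gaussBargmannFun f) (gaussBargmannFun_mem f)
  map_add' f g := Fock.ext fun z => by
    show gaussBargmannFun _ z = gaussBargmannFun _ z + gaussBargmannFun _ z
    unfold gaussBargmannFun
    rw [← mul_add, ← integral_add (integrable_kernel f z) (integrable_kernel g z)]
    congr 1
    refine integral_congr_ae ?_
    filter_upwards [Lp.coeFn_add f g] with ξ h
    rw [h, Pi.add_apply, add_mul]
  map_smul' c f := Fock.ext fun z => by
    show gaussBargmannFun _ z = c * gaussBargmannFun _ z
    unfold gaussBargmannFun
    rw [mul_left_comm, ← integral_const_mul c]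
    congr 1
    refine integral_congr_ae ?_
    filter_upwards [Lp.coeFn_smul c f] with ξ h
    rw [h, Pi.smul_apply, smul_eq_mul, mul_assoc]
  norm_map' f := by
    have h : ‖Fock.mk (gaussBargmannFun f) (gaussBargmannFun_mem f)‖ₑ ^ 2 = ‖f‖ₑ ^ 2 := by
      rw [Fock.enorm_sq, ← lintegral_gaussBargmannFun f]
      rfl
    have h' := (ENNReal.pow_right_strictMono two_ne_zero).injective h
    simpa [← ofReal_norm, ENNReal.ofReal_eq_ofReal_iff] using h'

/-- The adjoint `G* : 𝓕(ℂⁿ) → L²(ℝⁿ, dγ)`. -/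
def gaussBargmannAdjoint (n : ℕ) : Fock n →L[ℂ] GaussL2 n :=
  (ContinuousLinearMap.adjoint
    ((Fock.toL2 n).toContinuousLinearMap ∘L (gaussBargmann n).toContinuousLinearMap)) ∘L
      (Fock.toL2 n).toContinuousLinearMap

theorem inner_gaussBargmannAdjoint (f : GaussL2 n) (F : Fock n) :
    inner ℂ f (gaussBargmannAdjoint n F) = inner ℂ (gaussBargmann n f) F := by
  exact ContinuousLinearMap.adjoint_inner_right
    ((Fock.toL2 n).toContinuousLinearMap ∘L (gaussBargmann n).toContinuousLinearMap) f
    (Fock.toL2 n F)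

theorem gaussMeasure_le : gaussMeasure n ≤ volume := by
  have h : gaussMeasure n ≤ (volume : Measure (Rn n)).withDensity 1 := by
    refine withDensity_mono (.of_forall fun ξ => ?_)
    simp
  rwa [withDensity_one] at h

/-- The operator `f ↦ m f` on `L²(ℝⁿ, dγ)`, for `m ∈ L^∞(ℝⁿ)`. -/
def mulOp (m : Lp ℂ ∞ (volume : Measure (Rn n))) : GaussL2 n →L[ℂ] GaussL2 n :=
  (ContinuousLinearMap.mul ℂ ℂ).holderL (gaussMeasure n) ∞ 2 2
    (((Lp.memLp m).mono_measure gaussMeasure_le).toLp m)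

theorem gaussBargmann_apply (f : GaussL2 n) (z : Cn n) : gaussBargmann n f z =
    cexp ((z ⬝ᵥ z) / 4) * ∫ ξ, f ξ * cexp (I * (z ⬝ᵥ toCn ξ)) ∂(gaussMeasure n) := rfl

theorem coeFn_mulOp (m : Lp ℂ ∞ (volume : Measure (Rn n))) (f : GaussL2 n) :
    mulOp m f =ᵐ[gaussMeasure n] fun ξ => m ξ * f ξ := by
  filter_upwards [(ContinuousLinearMap.mul ℂ ℂ).coeFn_holder (r := 2)
    (((Lp.memLp m).mono_measure gaussMeasure_le).toLp m) f,
    ((Lp.memLp m).mono_measure gaussMeasure_le).coeFn_toLp] with ξ h1 h2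
  rw [h2] at h1
  exact h1

end FockSpace

end

open FockSpace

noncomputable section
namespace FockSpace
variable {n : ℕ}

/-! The transform G turns multiplication by the character e^{ia·ξ} into ρ(a)
(`gaussBargmann_mulOp_charLp`). Once G is known to be unitary, S commutes with every ρ(a) exactly
when T = G*SG commutes with every character, and it remains to show that such T are the
multiplications by bounded functions.

G is an isometry, so unitarity amounts to the range having trivial orthogonal complement
(`eq_zero_of_orthogonal_range`). A Gaussian integral shows that G maps exponentials to multiples of
the functions exp(z·w̄/2), that is, of ρ(-w)1. If F is orthogonal to them, then ⟨1, ρ(w)F⟩ =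
⟨ρ(-w)1, F⟩ = 0. By rotation invariance of ν and the mean value property, the left side is a nonzero
multiple of F(w).

For T commuting with characters (`exists_eq_mulOp_of_commute`), the symbol must be h = T1. Since T
e^{ia·ξ} = e^{ia·ξ} h, the conjugates of T*1_s and of 1_s h̄ have the same Fourier transform against
γ, hence T*1_s = 1_s h̄ for every measurable s. Comparing norms over all s gives |h| ≤ ‖T‖ almost
everywhere, and pairing Tf with indicators gives Tf = hf. Working with T* on indicators avoids
approximating functions by trigonometric sums. Conversely, multiplications commute with one another.
-/

theorem gaussMeasure_ac_volume : gaussMeasure n ≪ volume :=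
  withDensity_absolutelyContinuous _ _

/-- The density is everywhere positive. With the converse above, γ and Lebesgue measure have the
same null sets, so a symbol bounded γ-a.e. defines an element of L^∞(ℝⁿ). -/
theorem volume_ac_gaussMeasure : (volume : Measure (Rn n)) ≪ gaussMeasure n := by
  refine withDensity_absolutelyContinuous' (by fun_prop) (.of_forall fun ξ => ?_)
  simp only [ne_eq, ENNReal.ofReal_eq_zero, not_le]
  positivity

/-- Finiteness puts the indicator of every measurable set in L²(dγ). -/
instance : IsFiniteMeasure (gaussMeasure n) := by
  refine ⟨?_⟩
  have h := lintegral_gauss (n := n) 1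
  have h1 := lintegral_gaussian (n := n) one_pos
  simp only [neg_mul, one_mul] at h1
  simp only [Pi.one_apply, lintegral_one, mul_one, h1] at h
  rw [h]
  exact ENNReal.ofReal_lt_top

/-! ### Exponentials, characters and their intertwining with ρ -/

theorem memLp_kernel (w : Cn n) :
    MemLp (fun ξ : Rn n => cexp (I * (w ⬝ᵥ toCn ξ))) 2 (gaussMeasure n) := by
  refine (memLp_exp (n * ‖w‖)).of_le (continuous_kernel w).aestronglyMeasurable
    (.of_forall fun ξ => (norm_kernel_le w ξ).trans (le_of_eq ?_))
  rw [Complex.norm_exp, Complex.ofReal_re]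

/-- The exponential `ξ ↦ exp (i w·ξ)` in `L²(ℝⁿ, dγ)`. -/
def expL2 (w : Cn n) : GaussL2 n := (memLp_kernel w).toLp

theorem coeFn_expL2 (w : Cn n) :
    expL2 w =ᵐ[gaussMeasure n] fun ξ => cexp (I * (w ⬝ᵥ toCn ξ)) :=
  (memLp_kernel w).coeFn_toLp

theorem norm_kernel_toCn (a ξ : Rn n) : ‖cexp (I * (toCn a ⬝ᵥ toCn ξ))‖ = 1 := by
  have h : toCn a ⬝ᵥ toCn ξ = ((∑ j, a j * ξ j : ℝ) : ℂ) := by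
    simp [dotProduct, toCn]
  rw [h, mul_comm, Complex.norm_exp_ofReal_mul_I]

theorem memLp_char (a : Rn n) :
    MemLp (fun ξ : Rn n => cexp (I * (toCn a ⬝ᵥ toCn ξ))) ∞ (volume : Measure (Rn n)) :=
  memLp_top_of_bound (continuous_kernel _).aestronglyMeasurable 1
    (.of_forall fun ξ => (norm_kernel_toCn a ξ).le)

/-- The character `ξ ↦ exp (i a·ξ)` in `L^∞(ℝⁿ)`. -/
def charLp (a : Rn n) : Lp ℂ ∞ (volume : Measure (Rn n)) := (memLp_char a).toLp

theorem coeFn_mulOp_charLp (a : Rn n) (f : GaussL2 n) :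
    mulOp (charLp a) f =ᵐ[gaussMeasure n] fun ξ => cexp (I * (toCn a ⬝ᵥ toCn ξ)) * f ξ := by
  filter_upwards [coeFn_mulOp (charLp a) f,
    gaussMeasure_ac_volume.ae_le (memLp_char a).coeFn_toLp] with ξ h1 h2
  rw [h1, charLp, h2]

theorem mulOp_comm (m m' : Lp ℂ ∞ (volume : Measure (Rn n))) (f : GaussL2 n) :
    mulOp m (mulOp m' f) = mulOp m' (mulOp m f) := by
  refine Lp.ext ?_
  filter_upwards [coeFn_mulOp m (mulOp m' f), coeFn_mulOp m' (mulOp m f), coeFn_mulOp m f,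
    coeFn_mulOp m' f] with ξ h1 h2 h3 h4
  rw [h1, h2, h3, h4]
  ring

/-- Since `expL2 0` is the constant 1, an operator commuting with characters is determined on all
characters by its value at 1. -/
theorem mulOp_charLp_expL2_zero (a : Rn n) : mulOp (charLp a) (expL2 0) = expL2 (toCn a) := by
  refine Lp.ext ?_
  filter_upwards [coeFn_mulOp_charLp a (expL2 0), coeFn_expL2 (n := n) 0,
    coeFn_expL2 (toCn a)] with ξ h1 h2 h3
  rw [h1, h2, h3]
  simp

/-- `G` intertwines multiplication by `exp (i a·ξ)` and `ρ(a)`. -/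
theorem gaussBargmann_mulOp_charLp (a : Rn n) (f : GaussL2 n) :
    gaussBargmann n (mulOp (charLp a) f) = rho (toCn a) (gaussBargmann n f) := by
  refine Fock.ext fun z => ?_
  rw [rho_toCn_apply, gaussBargmann_apply, gaussBargmann_apply]
  have h1 : ∫ ξ, mulOp (charLp a) f ξ * cexp (I * (z ⬝ᵥ toCn ξ)) ∂(gaussMeasure n) =
      ∫ ξ, f ξ * cexp (I * ((z + toCn a) ⬝ᵥ toCn ξ)) ∂(gaussMeasure n) := by
    refine integral_congr_ae ?_
    filter_upwards [coeFn_mulOp_charLp a f] with ξ h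
    rw [h, add_dotProduct, mul_add, Complex.exp_add]
    ring
  have h2 : toCn a ⬝ᵥ toCn a = ((‖a‖ ^ 2 : ℝ) : ℂ) := by
    rw [EuclideanSpace.real_norm_sq_eq]
    simp [dotProduct, toCn, pow_two]
  have h3 : toCn a ⬝ᵥ z = z ⬝ᵥ toCn a := dotProduct_comm _ _
  rw [h1]
  generalize ∫ ξ, f ξ * cexp (I * ((z + toCn a) ⬝ᵥ toCn ξ)) ∂(gaussMeasure n) = J
  rw [mul_right_comm (cexp _) J, mul_right_comm (cexp _ * cexp _) J, ← Complex.exp_add,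
    ← Complex.exp_add]
  congr 2
  -- The exponents agree because (z+a)²/4 - z·a/2 - |a|²/4 = z²/4.
  simp only [add_dotProduct, dotProduct_add, h2, h3]
  ring

/-! ### Surjectivity of the Gauss–Bargmann transform -/

/-- The Gaussian integral yields π^{n/2} exp(-(w+z)²/4), and the prefactor exp(z²/4) cancels the
quadratic term in z. What remains is exponential in z: up to constants, these are the reproducing
kernels. -/
theorem gaussBargmann_expL2 (w z : Cn n) : gaussBargmann n (expL2 w) z =
    (Real.pi : ℂ) ^ ((n : ℂ) / 2) * cexp (-(w ⬝ᵥ w) / 4) * cexp (-(z ⬝ᵥ w) / 2) := by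
  have h1 : ∫ ξ, expL2 w ξ * cexp (I * (z ⬝ᵥ toCn ξ)) ∂(gaussMeasure n) =
      ∫ ξ : Rn n, cexp (-1 * ∑ j, (ξ j : ℂ) ^ 2 + ∑ j, (I * (w + z) j) * ξ j) := by
    have h2 : ∫ ξ, expL2 w ξ * cexp (I * (z ⬝ᵥ toCn ξ)) ∂(gaussMeasure n) =
        ∫ ξ, cexp (I * ((w + z) ⬝ᵥ toCn ξ)) ∂(gaussMeasure n) := by
      refine integral_congr_ae ?_
      filter_upwards [coeFn_expL2 w] with ξ h
      rw [h, ← Complex.exp_add, ← mul_add, add_dotProduct]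
    rw [h2, integral_gauss]
    refine integral_congr_ae (.of_forall fun ξ => ?_)
    simp only
    rw [← Complex.exp_add, EuclideanSpace.real_norm_sq_eq, add_comm]
    congr 2
    · simp
    · simp [dotProduct, toCn, Finset.mul_sum, mul_assoc]
  have h3 := GaussianFourier.integral_cexp_neg_mul_sum_add (b := 1) (by simp)
    fun j : Fin n => I * (w + z) j
  have h4 := (PiLp.volume_preserving_toLp (Fin n)).integral_comp
    (MeasurableEquiv.toLp 2 _).measurableEmbedding
    fun ξ : Rn n => cexp (-1 * ∑ j, (ξ j : ℂ) ^ 2 + ∑ j, (I * (w + z) j) * ξ j)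
  rw [gaussBargmann_apply, h1, ← h4]
  simp only at h3 ⊢
  rw [h3, mul_left_comm, div_one, Fintype.card_fin, mul_assoc, ← Complex.exp_add,
    ← Complex.exp_add]
  congr 2
  have h5 : ∑ j, (I * (w + z) j) ^ 2 = -((w + z) ⬝ᵥ (w + z)) := by
    simp only [mul_pow, Complex.I_sq, dotProduct, ← Finset.sum_neg_distrib]
    exact Finset.sum_congr rfl fun j _ => by ring
  have h6 : w ⬝ᵥ z = z ⬝ᵥ w := dotProduct_comm _ _
  rw [h5]
  simp only [add_dotProduct, dotProduct_add, h6]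
  ring

/-- Rotating every coordinate by c preserves Lebesgue measure, and the density of ν depends only on
the moduli |z_j|. -/
theorem measurePreserving_rotation (c : Circle) :
    MeasurePreserving (fun z : Cn n => (c : ℂ) • z) (fockMeasure n) (fockMeasure n) := by
  have h' : MeasurePreserving (fun z : Cn n => (c : ℂ) • z) volume volume :=
    volume_preserving_pi fun _ : Fin n => (rotation c).measurePreserving
  refine ⟨h'.measurable, ?_⟩
  refine Measure.ext fun s hs => ?_
  rw [Measure.map_apply h'.measurable hs, fockMeasure, withDensity_apply _ hs,
    withDensity_apply _ (h'.measurable hs), ← h'.setLIntegral_comp_preimage hs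
    measurable_fockDensity]
  have hc : ‖(c : ℂ)‖ = 1 := Circle.norm_coe c
  simp only [Pi.smul_apply, norm_smul, hc, one_mul]

/-- The constant function `1` lies in the Fock space. -/
theorem one_mem_fockSubmodule : (fun _ => 1 : Cn n → ℂ) ∈ fockSubmodule n := by
  have hc : (Real.pi : ℂ) ^ ((n : ℂ) / 2) ≠ 0 := by
    simp [Complex.cpow_eq_zero_iff, Real.pi_ne_zero]
  -- The transform of the constant 1 is the constant π^{n/2}, so rescaling it gives 1 without any
  -- integration over ℂⁿ.
  have h := (fockSubmodule n).smul_mem ((Real.pi : ℂ) ^ ((n : ℂ) / 2))⁻¹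
    (gaussBargmann n (expL2 0)).2
  convert h using 1
  funext z
  have h0 := gaussBargmann_expL2 0 z
  simp only [dotProduct_zero, neg_zero, zero_div, Complex.exp_zero, mul_one] at h0
  simp only [Pi.smul_apply, h0, smul_eq_mul]
  exact (inv_mul_cancel₀ hc).symm

instance : IsFiniteMeasure (fockMeasure n) := by
  have h := Fock.enorm_sq (Fock.mk _ (one_mem_fockSubmodule (n := n)))
  have h' : ∫⁻ z, ‖(Fock.mk _ (one_mem_fockSubmodule (n := n))) z‖ₑ ^ 2 ∂(fockMeasure n) =
      fockMeasure n Set.univ := by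
    simp [Fock.mk]
  exact ⟨by rw [← h', ← h]; exact ENNReal.pow_lt_top enorm_lt_top⟩

/-- The mean value property: the `ν`-average of `H` is `H 0`. -/
theorem integral_fock_eq (H : Fock n) :
    ∫ z, H z ∂(fockMeasure n) = (fockMeasure n).real Set.univ * H 0 := by
  have hH : Integrable H (fockMeasure n) := H.memLp.integrable one_le_two
  have hpi := Real.pi_pos
  have hcont : Continuous fun p : ℝ × Cn n => H (circleMap 0 1 p.1 • p.2) :=
    H.differentiable.continuous.comp
      (((continuous_circleMap 0 1).comp continuous_fst).smul continuous_snd)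
  have hrot : ∀ θ : ℝ, MeasurePreserving (fun z : Cn n => circleMap 0 1 θ • z)
      (fockMeasure n) (fockMeasure n) := fun θ => by
    have h := measurePreserving_rotation (n := n) (Circle.exp θ)
    simpa [circleMap] using h
  -- The double integral of H(e^{iθ}z) over θ and z is evaluated in both orders. Integrating in z
  -- first gives 2π ∫ H dν by rotation invariance.
  have hint : ∀ θ : ℝ, ∫ z, H (circleMap 0 1 θ • z) ∂(fockMeasure n) =
      ∫ z, H z ∂(fockMeasure n) := fun θ => by
    have h := integral_map (μ := fockMeasure n) (hrot θ).measurable.aemeasurable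
      (H.differentiable.continuous.aestronglyMeasurable)
    rw [← h, (hrot θ).map_eq]
  have hnorm : ∀ θ : ℝ, ∫ z, ‖H (circleMap 0 1 θ • z)‖ ∂(fockMeasure n) =
      ∫ z, ‖H z‖ ∂(fockMeasure n) := fun θ => by
    have h := integral_map (μ := fockMeasure n) (hrot θ).measurable.aemeasurable
      (H.differentiable.continuous.norm.aestronglyMeasurable)
    rw [← h, (hrot θ).map_eq]
  have hprod : Integrable (Function.uncurry fun (θ : ℝ) (z : Cn n) => H (circleMap 0 1 θ • z))
      ((volume.restrict (Set.uIoc 0 (2 * Real.pi))).prod (fockMeasure n)) := by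
    refine (integrable_prod_iff hcont.aestronglyMeasurable).2 ⟨.of_forall fun θ => (hrot θ).integrable_comp_of_integrable hH, ?_⟩
    simp only [hnorm]
    rw [Set.uIoc_of_le (by positivity)]
    exact integrable_const _
  have hswap := intervalIntegral_integral_swap hprod
  -- Integrating in θ first uses the one-variable mean value property of the entire function c ↦
  -- H(cz).
  have hmean : ∀ z : Cn n, ∫ θ in 0..2 * Real.pi, H (circleMap 0 1 θ • z) =
      2 * Real.pi * H 0 := fun z => by
    have hd : Differentiable ℂ fun c : ℂ => H (c • z) :=
      H.differentiable.comp (differentiable_id.smul_const z)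
    have h := (hd.diffContOnCl (s := Metric.ball 0 |1|)).circleAverage
    rw [Real.circleAverage_def, zero_smul] at h
    rw [← h, Complex.real_smul]
    push_cast
    rw [mul_inv_cancel_left₀ (by exact_mod_cast (by positivity : 2 * Real.pi ≠ 0))]
  simp only [hint, hmean, intervalIntegral.integral_const, integral_const, sub_zero,
    Complex.real_smul] at hswap
  have h2 : (2 * Real.pi : ℂ) ≠ 0 := by exact_mod_cast (by positivity : 2 * Real.pi ≠ 0)
  refine mul_left_cancel₀ h2 ?_
  push_cast at hswap
  rw [hswap]
  ring

theorem Fock.inner_eq (F H : Fock n) :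
    inner ℂ F H = ∫ z, inner ℂ (F z) (H z) ∂(fockMeasure n) := by
  refine integral_congr_ae ?_
  filter_upwards [F.memLp.coeFn_toLp, H.memLp.coeFn_toLp] with z h1 h2
  rw [← h1, ← h2]
  rfl

theorem fockMeasure_univ_ne_zero : (fockMeasure n).real Set.univ ≠ 0 := by
  rw [measureReal_ne_zero_iff]
  intro h
  exact isOpen_univ.measure_ne_zero volume Set.univ_nonempty (volume_ac_fockMeasure h)

/-- The function `ρ(-w)1` is a multiple of the transform of an exponential. -/
theorem exists_smul_gaussBargmann_expL2 (w : Cn n) : ∃ c : ℂ,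
    rho (-w) (Fock.mk _ one_mem_fockSubmodule) = c • gaussBargmann n (expL2 (-star w)) := by
  have hc : (Real.pi : ℂ) ^ ((n : ℂ) / 2) ≠ 0 := by
    simp [Complex.cpow_eq_zero_iff, Real.pi_ne_zero]
  -- Both sides are multiples of exp(z·w̄/2); c is the quotient of their constant factors.
  refine ⟨((Real.pi : ℂ) ^ ((n : ℂ) / 2) * cexp (-(-star w ⬝ᵥ -star w) / 4))⁻¹ *
    cexp (-(∑ j, ‖(-w) j‖ ^ 2 : ℝ) / 4), Fock.ext fun z => ?_⟩
  show 1 * cexp (-(z ⬝ᵥ star (-w)) / 2) * cexp (-(∑ j, ‖(-w) j‖ ^ 2 : ℝ) / 4) =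
    _ * gaussBargmann n (expL2 (-star w)) z
  rw [gaussBargmann_expL2, star_neg]
  have h1 := Complex.exp_ne_zero (-(-star w ⬝ᵥ -star w) / 4)
  field_simp

/-- This exhibits 1 as an image under the isometry ρ(w), so that ⟨1, ρ(w)F⟩ can be rewritten as
⟨ρ(-w)1, F⟩ without an adjoint of ρ(w). -/
theorem rho_rho_neg_one (w : Cn n) :
    rho w (rho (-w) (Fock.mk _ one_mem_fockSubmodule)) = Fock.mk _ one_mem_fockSubmodule := by
  refine Fock.ext fun z => ?_
  show 1 * cexp (-((z + w) ⬝ᵥ star (-w)) / 2) * cexp (-(∑ j, ‖(-w) j‖ ^ 2 : ℝ) / 4) *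
    cexp (-(z ⬝ᵥ star w) / 2) * cexp (-(∑ j, ‖w j‖ ^ 2 : ℝ) / 4) = 1
  have h : w ⬝ᵥ star w = ((∑ j, ‖w j‖ ^ 2 : ℝ) : ℂ) := by
    simp [dotProduct, Complex.mul_conj, Complex.normSq_eq_norm_sq]
  simp only [Pi.neg_apply, norm_neg, one_mul, ← Complex.exp_add, star_neg, dotProduct_neg,
    add_dotProduct, h]
  rw [← Complex.exp_zero]
  congr 1
  ring

/-- The value F(w) is a nonzero multiple of ⟨1, ρ(w)F⟩ = ⟨ρ(-w)1, F⟩, and ρ(-w)1 lies in the range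
of G. -/
theorem eq_zero_of_orthogonal_range (F : Fock n)
    (hF : ∀ f, inner ℂ (gaussBargmann n f) F = 0) : F = 0 := by
  refine Fock.ext fun w => ?_
  obtain ⟨c, hc⟩ := exists_smul_gaussBargmann_expL2 w
  have h1 : inner ℂ (Fock.mk _ one_mem_fockSubmodule) (rho w F) = 0 := by
    rw [← rho_rho_neg_one w, LinearIsometry.inner_map_map, hc, inner_smul_left, hF, mul_zero]
  have h2 : inner ℂ (Fock.mk _ one_mem_fockSubmodule) (rho w F) =
      ∫ z, rho w F z ∂(fockMeasure n) := by
    rw [Fock.inner_eq]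
    refine integral_congr_ae (.of_forall fun z => ?_)
    show rho w F z * star 1 = _
    simp
  rw [h2, integral_fock_eq, mul_eq_zero, Complex.ofReal_eq_zero,
    or_iff_right fockMeasure_univ_ne_zero] at h1
  have h3 : F (0 + w) * cexp (-(0 ⬝ᵥ star w) / 2) * cexp (-(∑ j, ‖w j‖ ^ 2 : ℝ) / 4) = 0 := h1
  show F w = 0
  simpa [Complex.exp_ne_zero] using h3

theorem gaussBargmannAdjoint_gaussBargmann (f : GaussL2 n) :
    gaussBargmannAdjoint n (gaussBargmann n f) = f := by
  refine ext_inner_left ℂ fun g => ?_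
  rw [inner_gaussBargmannAdjoint, LinearIsometry.inner_map_map]

/-- F - GG*F is orthogonal to the range of G, hence zero. With G*G = 1 this makes G unitary. -/
theorem gaussBargmann_gaussBargmannAdjoint (F : Fock n) :
    gaussBargmann n (gaussBargmannAdjoint n F) = F := by
  refine (sub_eq_zero.1 (eq_zero_of_orthogonal_range _ fun f => ?_)).symm
  rw [inner_sub_right, LinearIsometry.inner_map_map, inner_gaussBargmannAdjoint, sub_self]

/-! ### Operators commuting with characters -/

/-- A function in `L²(ℝⁿ, dγ)` whose Fourier transform against `γ` vanishes is zero. -/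
theorem eq_zero_of_integral_char_eq_zero (f : GaussL2 n)
    (hf : ∀ a : Rn n, ∫ ξ, f ξ * cexp (I * (toCn a ⬝ᵥ toCn ξ)) ∂(gaussMeasure n) = 0) : f = 0 := by
  have h0 : (𝓕 (auxFun f 0) : Rn n → ℂ) = 0 := by
    funext x
    have hpi := Real.pi_pos
    -- The factor -2π undoes the normalization of `𝓕`: the Fourier transform of f e^{-|ξ|²} at x is
    -- the integral of f against the character of frequency -2πx. Plancherel then forces f = 0.
    have h := integral_kernel_eq f ((-(2 * Real.pi)) • x) 0
    have hx : toComplex ((-(2 * Real.pi)) • x, 0) = toCn ((-(2 * Real.pi)) • x) := by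
      funext j
      apply Complex.ext <;> simp [toComplex, toCn]
    rw [hx, hf, smul_smul, neg_mul_neg, inv_mul_cancel₀ (by positivity), one_smul] at h
    exact h.symm
  have h1 := lintegral_fourier_sq _ (integrable_auxFun f 0) (memLp_auxFun f 0)
  rw [h0] at h1
  have h2 : ‖f‖ₑ ^ 2 = 0 := by
    rw [← lintegral_gaussL2 f]
    simp only [auxFun_enorm_sq, inner_zero_left, sub_zero, Pi.zero_apply, enorm_zero, ne_eq,
      OfNat.ofNat_ne_zero, not_false_eq_true, zero_pow, lintegral_zero] at h1
    have h3 := (lintegral_eq_zero_iff' ?_).1 h1.symm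
    · refine (lintegral_eq_zero_iff' ?_).2 ?_
      · exact ((Lp.stronglyMeasurable f).measurable.enorm.pow_const 2).mul (by fun_prop)
          |>.aemeasurable
      · filter_upwards [h3] with ξ h
        simp only [Pi.zero_apply, mul_eq_zero, ENNReal.ofReal_eq_zero] at h ⊢
        exact Or.inl (h.resolve_right (not_le.2 (Real.exp_pos _)))
    · exact ((Lp.stronglyMeasurable f).measurable.enorm.pow_const 2).mul (by fun_prop)
          |>.aemeasurable
  simpa using h2

/-- An operator on `L²(ℝⁿ, dγ)` whose adjoint multiplies indicators by `conj h` for an `h` in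
`L²(ℝⁿ, dγ)` has `h` bounded and is the multiplication by `h`. -/
theorem exists_eq_mulOp_of_adjoint_indicator (T : GaussL2 n →L[ℂ] GaussL2 n) (h : GaussL2 n)
    (hT : ∀ s (hs : MeasurableSet s),
      ContinuousLinearMap.adjoint T (indicatorConstLp 2 hs (measure_ne_top _ s) 1)
        =ᵐ[gaussMeasure n] s.indicator fun ξ => star (h ξ)) :
    ∃ m : Lp ℂ ∞ (volume : Measure (Rn n)), T = mulOp m := by
  -- For every s, ∫_s |h|² dγ = ‖T*1_s‖² ≤ ‖T‖² γ(s), which bounds |h|² pointwise almost everywhere.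
  have hbound : (fun ξ => ‖h ξ‖ₑ ^ 2) ≤ᵐ[gaussMeasure n] fun _ => ‖T‖ₑ ^ 2 := by
    refine ae_le_of_forall_setLIntegral_le_of_sigmaFinite
      ((Lp.stronglyMeasurable h).measurable.enorm.pow_const 2) fun s hs _ => ?_
    have hn : ∀ f : GaussL2 n, ‖f‖ₑ ^ 2 = ∫⁻ ξ, ‖f ξ‖ₑ ^ 2 ∂(gaussMeasure n) := fun f => by
      rw [← lintegral_gaussL2, lintegral_gauss]
      exact lintegral_congr fun ξ => mul_comm _ _
    have hind : ∀ u : Rn n → ℂ, ∫⁻ ξ, ‖s.indicator u ξ‖ₑ ^ 2 ∂(gaussMeasure n) =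
        ∫⁻ ξ in s, ‖u ξ‖ₑ ^ 2 ∂(gaussMeasure n) := fun u => by
      rw [← lintegral_indicator hs]
      refine lintegral_congr fun ξ => ?_
      by_cases hξ : ξ ∈ s <;> simp [hξ]
    have h1 : ‖ContinuousLinearMap.adjoint T (indicatorConstLp 2 hs (measure_ne_top _ s) 1)‖ₑ ^ 2 =
        ∫⁻ ξ in s, ‖h ξ‖ₑ ^ 2 ∂(gaussMeasure n) := by
      rw [hn, lintegral_congr_ae ((hT s hs).mono fun ξ e => by rw [e]), hind]
      simp only [← ofReal_norm, norm_star]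
    have h2 : ‖(indicatorConstLp 2 hs (measure_ne_top _ s) 1 : GaussL2 n)‖ₑ ^ 2 =
        ∫⁻ ξ in s, 1 ∂(gaussMeasure n) := by
      rw [hn, lintegral_congr_ae ((indicatorConstLp_coeFn).mono fun ξ e => by rw [e]), hind]
      simp
    have h3 := ContinuousLinearMap.le_opENorm (ContinuousLinearMap.adjoint T)
      (indicatorConstLp 2 hs (measure_ne_top _ s) 1)
    have h4 : ‖ContinuousLinearMap.adjoint T‖ₑ = ‖T‖ₑ := by
      rw [← ofReal_norm, LinearIsometryEquiv.norm_map, ofReal_norm]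
    rw [← h1]
    refine (pow_le_pow_left₀ zero_le h3 2).trans (le_of_eq ?_)
    rw [mul_pow, h2, h4]
    simp
  have hbound' : ∀ᵐ ξ ∂(volume : Measure (Rn n)), ‖h ξ‖ ≤ ‖T‖ := by
    filter_upwards [volume_ac_gaussMeasure.ae_le hbound] with ξ hξ
    rw [← enorm_le_iff_norm_le]
    exact (ENNReal.pow_right_strictMono two_ne_zero).le_iff_le.1 hξ
  have hmem : MemLp h ∞ (volume : Measure (Rn n)) :=
    memLp_top_of_bound (Lp.stronglyMeasurable h).aestronglyMeasurable _ hbound'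
  refine ⟨hmem.toLp, ContinuousLinearMap.ext fun f => sub_eq_zero.1 ?_⟩
  rw [Lp.eq_zero_iff_ae_eq_zero]
  refine Lp.ae_eq_zero_of_forall_setIntegral_eq_zero _ (by norm_num) (by norm_num)
    (fun s hs hμ => integrableOn_Lp_of_measure_ne_top _ one_le_two hμ.ne) fun s hs hμ => ?_
  -- The integral of Tf over s is ⟨1_s, Tf⟩ = ⟨T*1_s, f⟩, which equals ∫_s hf dγ.
  rw [← L2.inner_indicatorConstLp_one hs (measure_ne_top _ s), inner_sub_right,
    ← ContinuousLinearMap.adjoint_inner_left, sub_eq_zero]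
  refine integral_congr_ae ?_
  filter_upwards [hT s hs, indicatorConstLp_coeFn (p := 2) (hs := hs)
    (hμs := measure_ne_top (gaussMeasure n) s) (c := (1 : ℂ)), coeFn_mulOp hmem.toLp f,
    gaussMeasure_ac_volume.ae_le hmem.coeFn_toLp] with ξ h1 h2 h3 h4
  rw [h1, h2, h3, h4]
  by_cases hξ : ξ ∈ s <;> simp [hξ, mul_comm]

/-- The operators on `L²(ℝⁿ, dγ)` that commute with multiplication by characters are the
multiplication operators. -/
theorem exists_eq_mulOp_of_commute (T : GaussL2 n →L[ℂ] GaussL2 n)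
    (hT : ∀ a f, T (mulOp (charLp a) f) = mulOp (charLp a) (T f)) :
    ∃ m : Lp ℂ ∞ (volume : Measure (Rn n)), T = mulOp m := by
  -- A multiplication operator sends 1 to its symbol, so T1 is the only candidate.
  refine exists_eq_mulOp_of_adjoint_indicator T (T (expL2 0)) fun s hs => ?_
  set g : GaussL2 n := indicatorConstLp 2 hs (measure_ne_top _ s) 1 with hg
  set u := ContinuousLinearMap.adjoint T g with hu
  set v : GaussL2 n := ((Lp.memLp (T (expL2 0))).indicator hs).toLp with hv
  -- The inner product is conjugate linear in its first argument, so it is the conjugate of u =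
  -- T*1_s whose Fourier transform is ⟨u, e^{ia·ξ}⟩.
  have hu' : ∀ a : Rn n, ∫ ξ, (star u : GaussL2 n) ξ * cexp (I * (toCn a ⬝ᵥ toCn ξ))
      ∂(gaussMeasure n) = inner ℂ u (expL2 (toCn a)) := fun a => by
    refine integral_congr_ae ?_
    filter_upwards [Lp.coeFn_star u, coeFn_expL2 (toCn a)] with ξ h1 h2
    rw [h1, h2]
    simp [mul_comm]
  have hv' : ∀ a : Rn n, ∫ ξ, v ξ * cexp (I * (toCn a ⬝ᵥ toCn ξ)) ∂(gaussMeasure n) =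
      inner ℂ g (mulOp (charLp a) (T (expL2 0))) := fun a => by
    refine integral_congr_ae ?_
    filter_upwards [((Lp.memLp (T (expL2 0))).indicator hs).coeFn_toLp,
      coeFn_mulOp_charLp a (T (expL2 0)), indicatorConstLp_coeFn (p := 2) (hs := hs)
      (hμs := measure_ne_top (gaussMeasure n) s) (c := (1 : ℂ))] with ξ h1 h2 h3
    rw [h1, h2, h3]
    by_cases hξ : ξ ∈ s <;> simp [hξ, mul_comm]
  have huv : star u - v = 0 := by
    refine eq_zero_of_integral_char_eq_zero _ fun a => ?_
    have e : ∫ ξ, (star u - v) ξ * cexp (I * (toCn a ⬝ᵥ toCn ξ)) ∂(gaussMeasure n) =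
        ∫ ξ, ((star u : GaussL2 n) ξ * cexp (I * (toCn a ⬝ᵥ toCn ξ)) -
          v ξ * cexp (I * (toCn a ⬝ᵥ toCn ξ))) ∂(gaussMeasure n) := by
      refine integral_congr_ae ?_
      filter_upwards [Lp.coeFn_sub (star u) v] with ξ h
      rw [h, Pi.sub_apply, sub_mul]
    -- This is where commutation enters: ⟨T*1_s, e^{ia·ξ}⟩ = ⟨1_s, T(e^{ia·ξ}1)⟩ = ⟨1_s, e^{ia·ξ}
    -- T1⟩.
    rw [e, integral_sub (integrable_kernel _ _) (integrable_kernel _ _), hu', hv', hu,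
      ContinuousLinearMap.adjoint_inner_left, ← hT, mulOp_charLp_expL2_zero, sub_self]
  rw [sub_eq_zero] at huv
  have h1 := Lp.coeFn_star u
  rw [huv] at h1
  filter_upwards [h1, ((Lp.memLp (T (expL2 0))).indicator hs).coeFn_toLp] with ξ h2 h3
  have h4 : star (u ξ) = v ξ := h2.symm
  rw [← star_star (u ξ), h4, hv, h3]
  by_cases hξ : ξ ∈ s <;> simp [hξ]

/-! ### Transfer back to the Fock space -/

theorem gaussBargmann_mulOp_apply (m : Lp ℂ ∞ (volume : Measure (Rn n))) (F : Fock n) (z : Cn n) :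
    gaussBargmann n (mulOp m (gaussBargmannAdjoint n F)) z = cexp ((z ⬝ᵥ z) / 4) *
      ∫ ξ, m ξ * gaussBargmannAdjoint n F ξ * cexp (I * (z ⬝ᵥ toCn ξ)) ∂(gaussMeasure n) := by
  rw [gaussBargmann_apply]
  congr 1
  refine integral_congr_ae ?_
  filter_upwards [coeFn_mulOp m (gaussBargmannAdjoint n F)] with ξ h
  rw [h]

/-- The integral formula is the value of GmG*F at z, and elements of the Fock space are genuine
functions, determined by their values at every point. -/
theorem forall_apply_eq_iff (S : Fock n →L[ℂ] Fock n) (m : Lp ℂ ∞ (volume : Measure (Rn n))) :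
    (∀ (F : Fock n) (z : Cn n), S F z = cexp ((z ⬝ᵥ z) / 4) *
      ∫ ξ, m ξ * gaussBargmannAdjoint n F ξ * cexp (I * (z ⬝ᵥ toCn ξ)) ∂(gaussMeasure n)) ↔
    S = (gaussBargmann n).toContinuousLinearMap ∘L mulOp m ∘L gaussBargmannAdjoint n := by
  simp only [← gaussBargmann_mulOp_apply]
  refine ⟨fun h => ContinuousLinearMap.ext fun F => Fock.ext (h F), fun h F z => ?_⟩
  rw [h]
  rfl

theorem gaussBargmannAdjoint_rho (a : Rn n) (F : Fock n) :
    gaussBargmannAdjoint n (rho (toCn a) F) = mulOp (charLp a) (gaussBargmannAdjoint n F) := by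
  conv_lhs => rw [← gaussBargmann_gaussBargmannAdjoint F]
  rw [← gaussBargmann_mulOp_charLp, gaussBargmannAdjoint_gaussBargmann]

/-- Conjugation by the unitary G carries the ρ(a) to the characters: forwards, G*SG is a
multiplication; backwards, multiplications commute. -/
theorem forall_commute_rho_iff (S : Fock n →L[ℂ] Fock n) :
    (∀ (a : Rn n) (F : Fock n), S (rho (toCn a) F) = rho (toCn a) (S F)) ↔
    ∃ m : Lp ℂ ∞ (volume : Measure (Rn n)),
      S = (gaussBargmann n).toContinuousLinearMap ∘L mulOp m ∘L gaussBargmannAdjoint n := by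
  constructor
  · intro h
    obtain ⟨m, hm⟩ := exists_eq_mulOp_of_commute
      (gaussBargmannAdjoint n ∘L S ∘L (gaussBargmann n).toContinuousLinearMap) fun a f => by
        show gaussBargmannAdjoint n (S (gaussBargmann n (mulOp (charLp a) f))) =
          mulOp (charLp a) (gaussBargmannAdjoint n (S (gaussBargmann n f)))
        rw [gaussBargmann_mulOp_charLp, h, gaussBargmannAdjoint_rho]
    refine ⟨m, ContinuousLinearMap.ext fun F => ?_⟩
    rw [← hm]
    show S F = gaussBargmann n (gaussBargmannAdjoint n (S (gaussBargmann n
      (gaussBargmannAdjoint n F))))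
    rw [gaussBargmann_gaussBargmannAdjoint, gaussBargmann_gaussBargmannAdjoint]
  · rintro ⟨m, rfl⟩ a F
    show gaussBargmann n (mulOp m (gaussBargmannAdjoint n (rho (toCn a) F))) =
      rho (toCn a) (gaussBargmann n (mulOp m (gaussBargmannAdjoint n F)))
    rw [gaussBargmannAdjoint_rho, mulOp_comm, gaussBargmann_mulOp_charLp]

end FockSpace
end

theorem theorem1p2 (n : ℕ) (S : Fock n →L[ℂ] Fock n) :
    ((∀ (a : Rn n) (F : Fock n), S (rho (toCn a) F) = rho (toCn a) (S F)) ↔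
      ∃ m : Lp ℂ ∞ (volume : Measure (Rn n)), ∀ (F : Fock n) (z : Cn n),
        S F z = cexp ((z ⬝ᵥ z) / 4) *
          ∫ ξ, m ξ * gaussBargmannAdjoint n F ξ * cexp (I * (z ⬝ᵥ toCn ξ)) ∂(gaussMeasure n)) ∧
    ∀ m : Lp ℂ ∞ (volume : Measure (Rn n)),
      (∀ (F : Fock n) (z : Cn n),
        S F z = cexp ((z ⬝ᵥ z) / 4) *
          ∫ ξ, m ξ * gaussBargmannAdjoint n F ξ * cexp (I * (z ⬝ᵥ toCn ξ)) ∂(gaussMeasure n)) ↔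
      S = (gaussBargmann n).toContinuousLinearMap ∘L mulOp m ∘L gaussBargmannAdjoint n := by
  simp only [forall_apply_eq_iff, forall_commute_rho_iff, implies_true, and_self]
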